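/- Let $\mathcal R$ be the Levi-Civita field: the set of functions $f:\mathbb Q\to\mathbb R$ whose support has only finitely many elements below any given rational, with pointwise addition and convolution as multiplication, ordered by declaring $f\neq 0$ positive iff its value at the least element of its support is positive, and equipped with the order topology. Let $\tau\in\mathcal R$ be the function with $\tau(1)=1$ and $\tau(q)=0$ for $q\ne 1$. For $m\in\mathbb Z$ write $o(\tau^m)$ for an element of the form $\sum_{k\ge m+1}a_k\tau^k$ ($k\in\mathbb Z$, $a_k\in\mathbb R$). A network $\Gamma=(V,\rho,a_0,B)$ over an ordered field $K$ consists of a locally finite connected graph on a vertex set $V$ with $|V|\ge 2$, a symmetric function $\rho:V\times V\to K$ (the admittance) that is positive on edges and zero on all other pairs, a vertex $a_0$, and a non-empty set $B\subseteq V\setminus\{a_0\}$. If $\Gamma$ is finite, its effective admittance is $\mathcal P_{\mathrm{eff}}(\Gamma)=\sum_{x\sim a_0}(1-v(x))\rho_{xa_0}$, where $v:V\to K$ is the solution of the Dirichlet problem $\sum_y (v(y)-v(x))\rho_{xy}=0$ for $x\notin B\cup\{a_0\}$, $v=0$ on $B$, $v(a_0)=1$. If $\Gamma$ is infinite, it is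 exhausted by the finite networks $\Gamma_n=(V_n,\rho|_{V_n},a_0,(B\cap V_n)\cup\partial V_n)$, $n\ge 1$, where $V_n=\{x:\operatorname{dist}(a_0,x)\le n\}$ and $\partial V_n=\{x:\operatorname{dist}(a_0,x)=n\}$. Let $L,C>0$ be real numbers and put $\alpha=C\tau^{-1}$, $\beta=L^{-1}\tau$. Let $\Gamma$ be the $CL$-ladder network over $\mathcal R$: its vertices are $a_0,a_1,a_2,\dots,x_1,x_2,\dots$, its admittances are $\rho_{a_0x_1}=\alpha$, $\rho_{x_ix_{i+1}}=\alpha$ and $\rho_{a_ix_i}=\beta$ for $i\ge1$, and $\rho_{xy}=0$ for all other pairs, and $B=\{a_1,a_2,\dots\}$. Let $\Gamma_n$, $n\ge1$, be the finite networks exhausting $\Gamma$. Then, for every $n\ge 1$, the Dirichlet problem on $\Gamma_n$ has a unique solution, and the sequence $\{\mathcal P_{\mathrm{eff}}(\Gamma_n)\}_{n\ge1}$ does not converge in $\mathcal R$. More precisely, for every $n\ge1$, $$\mathcal P_{\mathrm{eff}}(\Gamma_{n+1})-\mathcal P_{\mathrm{eff}}(\Gamma_n)=-\frac{C}{n(n+1)}\,\tau^{-1}+o(\tau^{-1}),\qquad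 \left|\mathcal P_{\mathrm{eff}}(\Gamma_{n+1})-\mathcal P_{\mathrm{eff}}(\Gamma_n)\right|>\tau,$$ so that the sequence is not a Cauchy sequence in $\mathcal R$. -/

import Mathlib

/-! ### Networks over an ordered field -/

/-- A network `(V, ρ, a₀, B)` over an ordered field `K`: a locally finite connected graph with at
least two vertices, a positive admittance on the edges (extended by `0` to all pairs of vertices),
a vertex `a₀` and a non-empty set `B` of vertices not containing `a₀`. -/
structure Network (K : Type*) [Field K] [LinearOrder K] [IsStrictOrderedRing K] (V : Type*) where
  graph : SimpleGraph V
  nontrivial : Nontrivial V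
  locallyFinite : ∀ x, (graph.neighborSet x).Finite
  connected : graph.Connected
  ρ : V → V → K
  ρ_symm : ∀ x y, ρ x y = ρ y x
  ρ_pos : ∀ x y, graph.Adj x y → 0 < ρ x y
  ρ_eq_zero : ∀ x y, ¬ graph.Adj x y → ρ x y = 0
  a₀ : V
  B : Set V
  B_nonempty : B.Nonempty
  a₀_notMem : a₀ ∉ B

namespace Network

variable {K : Type*} [Field K] [LinearOrder K] [IsStrictOrderedRing K] {V : Type*}

/-- `Δ_ρ v (x) = ∑_y (v(y) - v(x)) ρ_{xy}`; only the finitely many neighbours of `x` contribute. -/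
noncomputable def laplacian (Γ : Network K V) (v : V → K) (x : V) : K :=
  ∑ᶠ y, (v y - v x) * Γ.ρ x y

/-- `v` solves the Dirichlet problem: `Δ_ρ v = 0` off `B ∪ {a₀}`, `v = 0` on `B`, `v(a₀) = 1`. -/
def IsDirichletSolution (Γ : Network K V) (v : V → K) : Prop :=
  (∀ x, x ∉ Γ.B → x ≠ Γ.a₀ → Γ.laplacian v x = 0) ∧ (∀ x ∈ Γ.B, v x = 0) ∧ v Γ.a₀ = 1

/-- The solution of the Dirichlet problem (an arbitrary function if there is none). -/
noncomputable def dirichletSolution (Γ : Network K V) : V → K :=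
  Classical.epsilon Γ.IsDirichletSolution

/-- The effective admittance `∑_{x ∼ a₀} (1 - v(x)) ρ_{x a₀}`, `v` the Dirichlet solution. -/
noncomputable def effectiveAdmittance (Γ : Network K V) : K :=
  ∑ᶠ x, (1 - Γ.dirichletSolution x) * Γ.ρ x Γ.a₀

/-- `V_n = {x | dist(a₀, x) ≤ n}`. -/
def distBall (Γ : Network K V) (n : ℕ) : Set V := {x | Γ.graph.dist Γ.a₀ x ≤ n}

theorem a₀_mem_distBall (Γ : Network K V) (n : ℕ) : Γ.a₀ ∈ Γ.distBall n := by
  simp [distBall]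

/-- A vertex at distance `n + 1` from `a₀` has a neighbour at distance `n`. -/
theorem exists_adj_dist (Γ : Network K V) {n : ℕ} {x : V} (hx : Γ.graph.dist Γ.a₀ x = n + 1) :
    ∃ y, Γ.graph.Adj y x ∧ Γ.graph.dist Γ.a₀ y = n := by
  obtain ⟨p, hp⟩ := Γ.connected.exists_walk_length_eq_dist x Γ.a₀
  rw [SimpleGraph.dist_comm, hx] at hp
  cases p with
  | nil => simp at hp
  | @cons _ y _ h q =>
    refine ⟨y, h.symm, ?_⟩
    have h1 : Γ.graph.dist Γ.a₀ y ≤ n := by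
      rw [SimpleGraph.dist_comm]
      refine (SimpleGraph.dist_le q).trans ?_
      simp only [SimpleGraph.Walk.length_cons] at hp
      omega
    have h2 := Γ.connected.dist_triangle (u := Γ.a₀) (v := y) (w := x)
    have h3 : Γ.graph.dist y x = 1 := SimpleGraph.dist_eq_one_iff_adj.mpr h.symm
    omega

theorem finite_distBall (Γ : Network K V) (n : ℕ) : (Γ.distBall n).Finite := by
  induction n with
  | zero =>
    refine (Set.finite_singleton Γ.a₀).subset fun x hx => ?_
    have hx : Γ.graph.dist Γ.a₀ x ≤ 0 := hx
    exact (Γ.connected.dist_eq_zero_iff.mp (Nat.le_zero.mp hx)).symm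
  | succ n ih =>
    refine (ih.union (ih.biUnion fun y _ => Γ.locallyFinite y)).subset fun x hx => ?_
    have hx : Γ.graph.dist Γ.a₀ x ≤ n + 1 := hx
    rcases Nat.lt_or_ge (Γ.graph.dist Γ.a₀ x) (n + 1) with h | h
    · exact Or.inl (Nat.lt_succ_iff.mp h)
    · obtain ⟨y, hy, hd⟩ := Γ.exists_adj_dist (le_antisymm hx h)
      exact Or.inr (Set.mem_biUnion (show y ∈ Γ.distBall n from hd.le) hy)

theorem exists_dist_eq (Γ : Network K V) [Infinite V] (n : ℕ) :
    ∃ x, Γ.graph.dist Γ.a₀ x = n := by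
  have hdown : ∀ k x, Γ.graph.dist Γ.a₀ x = n + k → ∃ y, Γ.graph.dist Γ.a₀ y = n := by
    intro k
    induction k with
    | zero => exact fun x hx => ⟨x, hx⟩
    | succ k ih =>
      intro x hx
      obtain ⟨y, -, hy⟩ := Γ.exists_adj_dist (n := n + k) hx
      exact ih y hy
  obtain ⟨x, hx⟩ := (Γ.finite_distBall n).infinite_compl.nonempty
  have hx : ¬ Γ.graph.dist Γ.a₀ x ≤ n := hx
  exact hdown (Γ.graph.dist Γ.a₀ x - n) x (by omega)

theorem connected_induce_distBall (Γ : Network K V) (n : ℕ) :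
    (Γ.graph.induce (Γ.distBall n)).Connected := by
  have key : ∀ k (x : Γ.distBall n), Γ.graph.dist Γ.a₀ x = k →
      (Γ.graph.induce (Γ.distBall n)).Reachable ⟨Γ.a₀, Γ.a₀_mem_distBall n⟩ x := by
    intro k
    induction k with
    | zero =>
      intro x hx
      have : Γ.a₀ = x := Γ.connected.dist_eq_zero_iff.mp hx
      have : (⟨Γ.a₀, Γ.a₀_mem_distBall n⟩ : Γ.distBall n) = x := Subtype.ext this
      rw [this]
    | succ k ih =>
      intro x hx
      obtain ⟨y, hy, hd⟩ := Γ.exists_adj_dist hx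
      have hxn : Γ.graph.dist Γ.a₀ x ≤ n := x.2
      have hyn : y ∈ Γ.distBall n := show Γ.graph.dist Γ.a₀ y ≤ n by omega
      refine (ih ⟨y, hyn⟩ hd).trans (SimpleGraph.Adj.reachable ?_)
      simpa using hy
  have : Nonempty (Γ.distBall n) := ⟨⟨Γ.a₀, Γ.a₀_mem_distBall n⟩⟩
  exact ⟨fun x y => (key _ x rfl).symm.trans (key _ y rfl)⟩

/-- The `n`-th finite network `Γ_n = (V_n, ρ|_{V_n}, a₀, (B ∩ V_n) ∪ ∂V_n)`, `n ≥ 1`, of the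
sequence exhausting the infinite network `Γ`, where `∂V_n = {x | dist(a₀, x) = n}`. -/
def exhaustion (Γ : Network K V) [Infinite V] (n : ℕ) (hn : n ≠ 0) :
    Network K (Γ.distBall n) where
  graph := Γ.graph.induce (Γ.distBall n)
  nontrivial := by
    obtain ⟨x, hx⟩ := Γ.exists_dist_eq n
    refine ⟨⟨Γ.a₀, Γ.a₀_mem_distBall n⟩, ⟨x, hx.le⟩, fun h => hn ?_⟩
    have h : Γ.a₀ = x := congrArg Subtype.val h
    rw [← hx, ← h, SimpleGraph.dist_self]
  locallyFinite := fun x =>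
    ((Γ.locallyFinite x).preimage Subtype.val_injective.injOn).subset fun y hy => by simpa using hy
  connected := Γ.connected_induce_distBall n
  ρ := fun x y => Γ.ρ x y
  ρ_symm := fun x y => Γ.ρ_symm x y
  ρ_pos := fun x y h => Γ.ρ_pos x y (by simpa using h)
  ρ_eq_zero := fun x y h => Γ.ρ_eq_zero x y (by simpa using h)
  a₀ := ⟨Γ.a₀, Γ.a₀_mem_distBall n⟩
  B := {x | (x : V) ∈ Γ.B ∨ Γ.graph.dist Γ.a₀ x = n}
  B_nonempty := by
    obtain ⟨x, hx⟩ := Γ.exists_dist_eq n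
    exact ⟨⟨x, hx.le⟩, Or.inr hx⟩
  a₀_notMem := by
    rintro (h | h)
    · exact Γ.a₀_notMem h
    · exact hn (by rw [← h, SimpleGraph.dist_self])

end Network

/-! ### The `αβ`-ladder -/

/-- The vertices of the ladder: `a i` is `a_i` (`i ≥ 0`), and `x i` is `x_{i+1}`. -/
inductive LadderVertex : Type
  | a : ℕ → LadderVertex
  | x : ℕ → LadderVertex

namespace LadderVertex

instance : Infinite LadderVertex :=
  Infinite.of_injective LadderVertex.a fun _ _ h => by injection h

variable {K : Type*} [Field K]

/-- `ρ_{a₀ x₁} = α`, `ρ_{x_i x_{i+1}} = α`, `ρ_{a_i x_i} = β` for `i ≥ 1`, symmetric, and `0`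
for all other pairs. -/
def admittance (α β : K) : LadderVertex → LadderVertex → K
  | a 0, x j => if j = 0 then α else 0
  | x j, a 0 => if j = 0 then α else 0
  | a (i + 1), x j => if i = j then β else 0
  | x j, a (i + 1) => if i = j then β else 0
  | x i, x j => if j = i + 1 ∨ i = j + 1 then α else 0
  | a _, a _ => 0

theorem admittance_symm (α β : K) (u v : LadderVertex) :
    admittance α β u v = admittance α β v u := by
  rcases u with (_ | i) | i <;> rcases v with (_ | j) | j <;> simp [admittance, or_comm]

theorem admittance_self (α β : K) (u : LadderVertex) : admittance α β u u = 0 := by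
  rcases u with (_ | i) | i <;> simp [admittance]

theorem admittance_nonneg [LinearOrder K] {α β : K} (hα : 0 < α) (hβ : 0 < β) (u v : LadderVertex) :
    0 ≤ admittance α β u v := by
  rcases u with (_ | i) | i <;> rcases v with (_ | j) | j <;> simp only [admittance] <;>
    first | exact le_rfl | (split_ifs <;> first | exact le_rfl | exact hα.le | exact hβ.le)

/-- The ladder graph: two vertices are joined by an edge iff the admittance of the pair is not
`0`. -/
def ladderGraph (α β : K) : SimpleGraph LadderVertex where
  Adj u v := admittance α β u v ≠ 0
  symm := ⟨fun u v h => by rwa [admittance_symm]⟩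
  loopless := ⟨fun u h => h (admittance_self α β u)⟩

theorem ladderGraph_connected [LinearOrder K] {α β : K} (hα : 0 < α) (hβ : 0 < β) :
    (ladderGraph α β).Connected := by
  have hx : ∀ i, (ladderGraph α β).Reachable (a 0) (x i) := by
    intro i
    induction i with
    | zero =>
      exact SimpleGraph.Adj.reachable
        (show admittance α β (a 0) (x 0) ≠ 0 by simpa [admittance] using hα.ne')
    | succ i ih =>
      exact ih.trans (SimpleGraph.Adj.reachable
        (show admittance α β (x i) (x (i + 1)) ≠ 0 by simpa [admittance] using hα.ne'))
  have h : ∀ u, (ladderGraph α β).Reachable (a 0) u := by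
    rintro ((_ | i) | i)
    · exact SimpleGraph.Reachable.refl _
    · exact (hx i).trans (SimpleGraph.Adj.reachable
        (show admittance α β (x i) (a (i + 1)) ≠ 0 by simpa [admittance] using hβ.ne'))
    · exact hx i
  have : Nonempty LadderVertex := ⟨a 0⟩
  exact ⟨fun u v => (h u).symm.trans (h v)⟩

theorem ladderGraph_locallyFinite (α β : K) (u : LadderVertex) :
    ((ladderGraph α β).neighborSet u).Finite := by
  have key : ∀ v, admittance α β u v ≠ 0 →
      v ∈ (match u with
        | a i => {x i, x (i - 1)}
        | x i => {a 0, a (i + 1), x (i + 1), x (i - 1)} : Set LadderVertex) := by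
    intro v hv
    rcases u with (_ | i) | i <;> rcases v with (_ | j) | j <;> simp [admittance] at hv ⊢ <;> omega
  refine Set.Finite.subset ?_ key
  rcases u with i | i <;> simp

/-- The infinite ladder network with series admittance `α` and shunt admittance `β`; the vertices
`a₁, a₂, …` are grounded. -/
def ladder [LinearOrder K] [IsStrictOrderedRing K] (α β : K) (hα : 0 < α) (hβ : 0 < β) : Network K LadderVertex where
  graph := ladderGraph α β
  nontrivial := inferInstance
  locallyFinite := ladderGraph_locallyFinite α β
  connected := ladderGraph_connected hα hβ
  ρ := admittance α β
  ρ_symm := admittance_symm α β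
  ρ_pos := fun u v h => lt_of_le_of_ne (admittance_nonneg hα hβ u v) (Ne.symm h)
  ρ_eq_zero := fun _ _ h => not_not.mp h
  a₀ := a 0
  B := {u | ∃ i, u = a (i + 1)}
  B_nonempty := ⟨a 1, 0, rfl⟩
  a₀_notMem := by simp

end LadderVertex

/-! ### The Levi-Civita field -/

/-- A set of rationals is left-finite if it has only finitely many elements below any rational. -/
def LeftFinite (M : Set ℚ) : Prop := ∀ r : ℚ, {q | q ∈ M ∧ q < r}.Finite

namespace LeftFinite

theorem mono {M N : Set ℚ} (hN : LeftFinite N) (h : M ⊆ N) : LeftFinite M := fun r =>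
  (hN r).subset fun _ hq => ⟨h hq.1, hq.2⟩

theorem union {M N : Set ℚ} (hM : LeftFinite M) (hN : LeftFinite N) : LeftFinite (M ∪ N) :=
  fun r => ((hM r).union (hN r)).subset fun _ hq => hq.1.imp (fun h => ⟨h, hq.2⟩) fun h => ⟨h, hq.2⟩

theorem singleton (q : ℚ) : LeftFinite {q} := fun _ =>
  (Set.finite_singleton q).subset fun _ h => h.1

theorem add {f g : HahnSeries ℚ ℝ} (hf : LeftFinite f.support) (hg : LeftFinite g.support) :
    LeftFinite (f + g).support :=
  (hf.union hg).mono (HahnSeries.support_add_subset _ _)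

theorem mul {f g : HahnSeries ℚ ℝ} (hf : LeftFinite f.support) (hg : LeftFinite g.support) :
    LeftFinite (f * g).support := by
  intro r
  refine ((hf (r - g.order)).add (hg (r - f.order))).subset ?_
  rintro q ⟨hq, hqr⟩
  obtain ⟨i, hi, j, hj, rfl⟩ := HahnSeries.support_mul_subset hq
  have h1 : f.order ≤ i := HahnSeries.order_le_of_coeff_ne_zero hi
  have h2 : g.order ≤ j := HahnSeries.order_le_of_coeff_ne_zero hj
  simp only at hqr
  exact ⟨i, ⟨hi, by linarith⟩, j, ⟨hj, by linarith⟩, rfl⟩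

theorem neg {f : HahnSeries ℚ ℝ} (hf : LeftFinite f.support) : LeftFinite (-f).support := by
  rwa [HahnSeries.support_neg]

theorem single (q : ℚ) (c : ℝ) : LeftFinite (HahnSeries.single q c).support :=
  (singleton q).mono HahnSeries.support_single_subset

theorem one : LeftFinite (1 : HahnSeries ℚ ℝ).support := single 0 1

theorem pow {f : HahnSeries ℚ ℝ} (hf : LeftFinite f.support) (n : ℕ) :
    LeftFinite (f ^ n).support := by
  induction n with
  | zero => simpa using one
  | succ n ih => rw [pow_succ]; exact ih.mul hf

theorem sum {ι : Type*} (s : Finset ι) (f : ι → HahnSeries ℚ ℝ)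
    (hf : ∀ i, LeftFinite (f i).support) : LeftFinite (∑ i ∈ s, f i).support := by
  classical
  induction s using Finset.induction_on with
  | empty => intro r; simp
  | insert i s hi ih => rw [Finset.sum_insert hi]; exact (hf i).add ih

/-- The inverse of a Hahn series with left-finite support has left-finite support. -/
theorem inv {f : HahnSeries ℚ ℝ} (hf : LeftFinite f.support) : LeftFinite (f⁻¹).support := by
  by_cases hf0 : f = 0
  · subst hf0; rw [inv_zero]; exact hf
  have hc : f.leadingCoeff ≠ 0 := HahnSeries.leadingCoeff_ne_zero.mpr hf0
  set u : HahnSeries ℚ ℝ := HahnSeries.single (-f.order) f.leadingCoeff⁻¹ with hu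
  have hu0 : u ≠ 0 := HahnSeries.single_ne_zero (inv_ne_zero hc)
  set y : HahnSeries ℚ ℝ := 1 - u * f with hy
  have hypos : 0 < y.orderTop :=
    HahnSeries.unit_aux f (inv_mul_cancel₀ hc) _ (neg_add_cancel f.order)
  have hyl : LeftFinite y.support := by
    rw [hy, sub_eq_add_neg]
    exact one.add ((single _ _).mul hf).neg
  have hfz : f⁻¹ = u * (1 - y)⁻¹ := by
    rw [hy, sub_sub_cancel, mul_inv, ← mul_assoc, mul_inv_cancel₀ hu0, one_mul]
  rw [hfz]
  refine (single _ _).mul ?_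
  by_cases hy0 : y = 0
  · rw [hy0, sub_zero, inv_one]; exact one
  have h1y : 1 - y ≠ 0 := by
    rw [hy, sub_sub_cancel]; exact mul_ne_zero hu0 hf0
  have hyo : 0 < y.order := by
    rw [← HahnSeries.order_eq_orderTop_of_ne_zero hy0] at hypos
    exact_mod_cast hypos
  set z := (1 - y)⁻¹ with hz
  have hz0 : z ≠ 0 := inv_ne_zero h1y
  intro r
  obtain ⟨n, hn⟩ := exists_nat_gt ((r - z.order) / y.order)
  have hn : r < n * y.order + z.order := by
    rw [div_lt_iff₀ hyo] at hn; linarith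
  have hgeom : z = ∑ k ∈ Finset.range n, y ^ k + y ^ n * z := by
    have h := mul_neg_geom_sum y n
    have h2 : z * (1 - y) = 1 := inv_mul_cancel₀ h1y
    calc z = z * ((1 - y) * ∑ k ∈ Finset.range n, y ^ k) + y ^ n * z := by rw [h]; ring
      _ = _ := by rw [← mul_assoc, h2, one_mul]
  refine (sum (Finset.range n) (fun k => y ^ k) (fun k => hyl.pow k) r).subset ?_
  rintro q ⟨hq, hqr⟩
  refine ⟨?_, hqr⟩
  have hlow : (y ^ n * z).coeff q = 0 := by
    apply HahnSeries.coeff_eq_zero_of_lt_order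
    rw [HahnSeries.order_mul (pow_ne_zero n hy0) hz0, HahnSeries.order_pow, nsmul_eq_mul]
    linarith
  rw [HahnSeries.mem_support, hgeom, HahnSeries.coeff_add, hlow, add_zero] at hq
  exact hq

end LeftFinite

/-- The Levi-Civita field: functions `ℚ → ℝ` with left-finite support, with pointwise addition and
convolution as multiplication, as a subfield of the lexicographically ordered field of Hahn series
`ℝ((τ^ℚ))`. An element is positive iff its lowest non-zero coefficient is positive. -/
noncomputable def leviCivitaSubfield : Subfield (Lex (HahnSeries ℚ ℝ)) where
  carrier := {f | LeftFinite (ofLex f).support}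
  mul_mem' := fun hf hg => LeftFinite.mul hf hg
  one_mem' := LeftFinite.one
  add_mem' := fun hf hg => LeftFinite.add hf hg
  zero_mem' := fun r => by simp
  neg_mem' := fun hf => LeftFinite.neg hf
  inv_mem' := fun _ hf => LeftFinite.inv hf

/-- The type of elements of the Levi-Civita field. -/
abbrev LeviCivita : Type := leviCivitaSubfield

namespace LeviCivita

/-- The order topology. -/
instance : TopologicalSpace LeviCivita := Preorder.topology LeviCivita

instance : OrderTopology LeviCivita := ⟨rfl⟩

/-- The value of `f : ℚ → ℝ` at `q`, i.e. the coefficient of `τ^q`. -/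
def coeff (f : LeviCivita) (q : ℚ) : ℝ := (ofLex (f : Lex (HahnSeries ℚ ℝ))).coeff q

/-- The element `c τ^q`, i.e. the function with value `c` at `q` and `0` elsewhere. -/
noncomputable def monomial (q : ℚ) (c : ℝ) : LeviCivita :=
  ⟨toLex (HahnSeries.single q c), LeftFinite.single q c⟩

/-- The infinitesimal `τ`. -/
noncomputable def τ : LeviCivita := monomial 1 1

/-- The real number `c` as an element of the Levi-Civita field. -/
noncomputable def const (c : ℝ) : LeviCivita := monomial 0 c

theorem monomial_pos (q : ℚ) {c : ℝ} (hc : 0 < c) : 0 < monomial q c := by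
  change (0 : Lex (HahnSeries ℚ ℝ)) < toLex (HahnSeries.single q c)
  rw [← HahnSeries.leadingCoeff_pos_iff]
  simpa using hc

theorem τ_pos : 0 < τ := monomial_pos 1 one_pos

theorem const_pos {c : ℝ} (hc : 0 < c) : 0 < const c := monomial_pos 0 hc

/-- `f = o(τ^m)`: `f = ∑_{k ≥ m+1} a_k τ^k`, a series in integer powers of `τ` above the
`m`-th. -/
def IsLittleO (f : LeviCivita) (m : ℤ) : Prop :=
  ∀ q : ℚ, f.coeff q ≠ 0 → ∃ k : ℤ, m + 1 ≤ k ∧ q = k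

end LeviCivita

/-- The `CL`-network: the ladder over the Levi-Civita field with series admittance `C τ⁻¹` and shunt
admittance `L⁻¹ τ`. -/
noncomputable def clNetwork (L C : ℝ) (hL : 0 < L) (hC : 0 < C) :
    Network LeviCivita LadderVertex :=
  LadderVertex.ladder (LeviCivita.const C * LeviCivita.τ⁻¹) (LeviCivita.const L⁻¹ * LeviCivita.τ)
    (mul_pos (LeviCivita.const_pos hC) (inv_pos.mpr LeviCivita.τ_pos))
    (mul_pos (LeviCivita.const_pos (inv_pos.mpr hL)) LeviCivita.τ_pos)

/-!
Along the ladder the Dirichlet problem is the three-term recursion of the Chebyshev polynomials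
`S_m` at `t = 2 + β / α`, and `S_{-1} = 0` matches the condition at the far end `x_n`; uniqueness is
the maximum principle. This gives `P_eff(Γ_n) = α (1 - S_{n-2}(t) / S_{n-1}(t))`, and the invariant
`S_m² - S_{m+1} S_{m-1} = 1` turns consecutive differences into `-α / (S_{n-1}(t) S_n(t))`.
For the `CL`-network `t = 2 + τ² / (L C)`, so the denominator is a power series in `τ` with constant
term `S_{n-1}(2) S_n(2) = n (n + 1)`, whereas `α = C τ⁻¹`: the differences are infinitely large.
-/

/-! ### Harmonic functions on networks -/

namespace Network

variable {K : Type*} [Field K] [LinearOrder K] [IsStrictOrderedRing K] {V : Type*}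
  (Γ : Network K V)

theorem finite_support_mul_ρ (f : V → K) (x : V) :
    (Function.support fun y => f y * Γ.ρ x y).Finite :=
  (Γ.locallyFinite x).subset fun _ hy => by_contra fun h =>
    right_ne_zero_of_mul hy (Γ.ρ_eq_zero _ _ h)

theorem ρ_nonneg (x y : V) : 0 ≤ Γ.ρ x y := by
  by_cases h : Γ.graph.Adj x y
  · exact (Γ.ρ_pos x y h).le
  · exact (Γ.ρ_eq_zero x y h).ge

theorem laplacian_sub (v w : V → K) (x : V) :
    Γ.laplacian (v - w) x = Γ.laplacian v x - Γ.laplacian w x := by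
  simp only [laplacian]
  rw [← finsum_sub_distrib (Γ.finite_support_mul_ρ _ x) (Γ.finite_support_mul_ρ _ x)]
  exact finsum_congr fun y => by rw [Pi.sub_apply, Pi.sub_apply]; ring

variable {Γ}

theorem eq_of_adj_of_forall_le {v : V → K} {x y : V} (hmax : ∀ z, v z ≤ v x)
    (hsub : 0 ≤ Γ.laplacian v x) (hxy : Γ.graph.Adj x y) : v y = v x := by
  have hterm : (v x - v y) * Γ.ρ x y ≤ -Γ.laplacian v x := by
    rw [laplacian, ← finsum_neg_distrib]
    simp only [← neg_mul, neg_sub]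
    exact single_le_finsum y (Γ.finite_support_mul_ρ (fun z => v x - v z) x) fun z =>
      mul_nonneg (sub_nonneg.mpr (hmax z)) (Γ.ρ_nonneg x z)
  have hle : v x - v y ≤ 0 :=
    nonpos_of_mul_nonpos_left (hterm.trans (neg_nonpos.mpr hsub)) (Γ.ρ_pos x y hxy)
  exact (hmax y).antisymm (sub_nonpos.mp hle)

theorem le_of_subharmonic_of_le_on [Finite V] {S : Set V} (hS : S.Nonempty) {v : V → K} {M : K}
    (hsub : ∀ x ∉ S, 0 ≤ Γ.laplacian v x) (hle : ∀ x ∈ S, v x ≤ M) (x : V) : v x ≤ M := by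
  have := Γ.connected.nonempty
  obtain ⟨m, hm⟩ := Finite.exists_max v
  obtain ⟨s, hs⟩ := hS
  refine (hm x).trans (le_of_not_gt fun hMm => ?_)
  have hconst : ∀ {y z : V}, Γ.graph.Walk y z → v y = v m → v z = v m := by
    intro y z p hy
    induction p with
    | nil => exact hy
    | cons hadj _ ih =>
      have hnot : _ ∉ S := fun h => hMm.not_ge (hy ▸ hle _ h)
      exact ih ((eq_of_adj_of_forall_le (fun z => hy ▸ hm z) (hsub _ hnot) hadj).trans hy)
  obtain ⟨p⟩ := Γ.connected.preconnected m s
  exact hMm.not_ge (hconst p rfl ▸ hle s hs)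

namespace IsDirichletSolution

theorem le [Finite V] {v w : V → K} (hv : Γ.IsDirichletSolution v)
    (hw : Γ.IsDirichletSolution w) : v ≤ w := fun x => by
  refine sub_nonpos.mp (le_of_subharmonic_of_le_on (Γ := Γ) (S := insert Γ.a₀ Γ.B)
    (v := v - w) (Set.insert_nonempty _ _) (fun y hy => ?_) (fun y hy => ?_) x)
  · rw [Set.mem_insert_iff, not_or] at hy
    rw [laplacian_sub, hv.1 y hy.2 hy.1, hw.1 y hy.2 hy.1, sub_zero]
  · rcases hy with rfl | hy
    · rw [Pi.sub_apply, hv.2.2, hw.2.2, sub_self]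
    · rw [Pi.sub_apply, hv.2.1 y hy, hw.2.1 y hy, sub_self]

theorem eq [Finite V] {v w : V → K} (hv : Γ.IsDirichletSolution v)
    (hw : Γ.IsDirichletSolution w) : v = w :=
  (hv.le hw).antisymm (hw.le hv)

theorem effectiveAdmittance_eq [Finite V] {v : V → K} (hv : Γ.IsDirichletSolution v) :
    Γ.effectiveAdmittance = -Γ.laplacian v Γ.a₀ := by
  have hsol : Γ.dirichletSolution = v := (Classical.epsilon_spec ⟨v, hv⟩).eq hv
  rw [effectiveAdmittance, hsol, laplacian, ← finsum_neg_distrib]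
  exact finsum_congr fun y => by rw [hv.2.2, Γ.ρ_symm y, ← neg_mul, neg_sub]

end IsDirichletSolution

instance finite_distBall_coe (n : ℕ) : Finite (Γ.distBall n) := (Γ.finite_distBall n).to_subtype

theorem laplacian_exhaustion [Infinite V] {n : ℕ} (hn : n ≠ 0) (v : V → K)
    {x : Γ.distBall n} (hx : Γ.graph.dist Γ.a₀ x < n) :
    (Γ.exhaustion n hn).laplacian (fun y => v y) x = Γ.laplacian v x := by
  let f : V → K := fun y => (v y - v x) * Γ.ρ x y
  have hsupp : Function.support f ⊆ Γ.distBall n := fun y hy => by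
    have hadj : Γ.graph.Adj x y :=
      by_contra fun h => right_ne_zero_of_mul hy (Γ.ρ_eq_zero _ _ h)
    have := hadj.diff_dist_adj (u := Γ.a₀)
    change Γ.graph.dist Γ.a₀ y ≤ n
    omega
  change ∑ᶠ y : Γ.distBall n, f y = ∑ᶠ y, f y
  rw [finsum_set_coe_eq_finsum_mem, ← finsum_mem_univ f]
  refine finsum_mem_inter_support_eq f _ _ ?_
  rw [Set.univ_inter, Set.inter_eq_right.mpr hsupp]

theorem isDirichletSolution_exhaustion [Infinite V] {n : ℕ} (hn : n ≠ 0) {v : V → K}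
    (hharm : ∀ x ∉ Γ.B, x ≠ Γ.a₀ → Γ.laplacian v x = 0) (hB : ∀ x ∈ Γ.B, v x = 0)
    (hsphere : ∀ x, Γ.graph.dist Γ.a₀ x = n → v x = 0) (ha₀ : v Γ.a₀ = 1) :
    (Γ.exhaustion n hn).IsDirichletSolution fun x => v x := by
  refine ⟨fun x hx hxa₀ => ?_, fun x hx => hx.elim (hB x) (hsphere x), ha₀⟩
  obtain ⟨hxB, hxn⟩ := not_or.mp hx
  rw [laplacian_exhaustion hn v (lt_of_le_of_ne x.2 hxn)]
  exact hharm x hxB fun h => hxa₀ (Subtype.ext h)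

theorem effectiveAdmittance_exhaustion [Infinite V] {n : ℕ} (hn : n ≠ 0) {v : V → K}
    (hv : (Γ.exhaustion n hn).IsDirichletSolution fun x => v x) :
    (Γ.exhaustion n hn).effectiveAdmittance = -Γ.laplacian v Γ.a₀ := by
  rw [hv.effectiveAdmittance_eq, laplacian_exhaustion hn v]
  · rfl
  · exact (SimpleGraph.dist_self (G := Γ.graph)).trans_lt (Nat.pos_of_ne_zero hn)

end Network

/-! ### Chebyshev polynomials -/

section Chebyshev

open Polynomial Polynomial.Chebyshev

theorem eval_S_add_one {R : Type*} [CommRing R] (t : R) (m : ℤ) :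
    (S R (m + 1)).eval t = t * (S R m).eval t - (S R (m - 1)).eval t := by
  rw [S_add_one, eval_sub, eval_mul, eval_X]

theorem eval_S_sq_sub_mul {R : Type*} [CommRing R] (t : R) (m : ℤ) :
    (S R m).eval t ^ 2 - (S R (m + 1)).eval t * (S R (m - 1)).eval t = 1 := by
  have h := congrArg (eval t) (S_sq_add_S_sq R m)
  simp only [eval_sub, eval_add, eval_mul, eval_pow, eval_X, eval_one] at h
  linear_combination h - (S R (m + 1)).eval t * eval_S_add_one t m

theorem map_eval_S {R R' : Type*} [CommRing R] [CommRing R'] (φ : R →+* R') (t : R) (m : ℤ) :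
    φ ((S R m).eval t) = (S R' m).eval (φ t) := by
  rw [← map_S φ, eval_map_apply]

theorem eval_S_pos {R : Type*} [CommRing R] [LinearOrder R] [IsStrictOrderedRing R] {t : R}
    (ht : 2 ≤ t) (m : ℕ) : 0 < (S R m).eval t := by
  suffices h : 0 < (S R m).eval t ∧ (S R (m - 1)).eval t ≤ (S R m).eval t from h.1
  induction m with
  | zero => simp
  | succ m ih =>
    obtain ⟨hpos, hmono⟩ := ih
    have hle : (S R m).eval t ≤ (S R (m + 1)).eval t := by
      rw [eval_S_add_one]
      nlinarith
    push_cast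
    rw [add_sub_cancel_right]
    exact ⟨hpos.trans_le hle, hle⟩

theorem eval_S_sub_one_pos {R : Type*} [CommRing R] [LinearOrder R] [IsStrictOrderedRing R] {t : R}
    (ht : 2 ≤ t) {n : ℕ} (hn : n ≠ 0) : 0 < (S R (n - 1)).eval t := by
  obtain ⟨m, rfl⟩ := Nat.exists_eq_succ_of_ne_zero hn
  simpa using eval_S_pos ht m

end Chebyshev

/-! ### The finite ladders -/

theorem le_add_dist_of_forall_adj {V : Type*} {G : SimpleGraph V} {f : V → ℕ}
    (hf : ∀ u v, G.Adj u v → f v ≤ f u + 1) {u v : V} (huv : G.Reachable u v) :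
    f v ≤ f u + G.dist u v := by
  obtain ⟨p, hp⟩ := huv.exists_walk_length_eq_dist
  rw [← hp]
  clear hp huv
  induction p with
  | nil => simp
  | cons hadj p ih =>
    have := hf _ _ hadj
    rw [SimpleGraph.Walk.length_cons]
    omega

namespace LadderVertex

/-- The `k`-th vertex of the chain `a₀, x₁, x₂, …` of series edges. -/
def node : ℕ → LadderVertex
  | 0 => a 0
  | k + 1 => x k

/-- The subscript of a vertex in the paper's numbering: `i` for both `a_i` and `x_i`. -/
def subscript : LadderVertex → ℕ
  | a i => i
  | x i => i + 1

theorem subscript_node (k : ℕ) : subscript (node k) = k := by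
  cases k <;> rfl

open Polynomial Polynomial.Chebyshev

section Field

variable {K : Type*} [Field K] {α β : K}

theorem admittance_node_node_succ (α β : K) (k : ℕ) :
    admittance α β (node k) (node (k + 1)) = α := by
  cases k <;> simp [node, admittance]

theorem subscript_le_of_adj (u v : LadderVertex) (h : (ladderGraph α β).Adj u v) :
    subscript v ≤ subscript u + 1 := by
  have h : admittance α β u v ≠ 0 := h
  rcases u with (_ | i) | i <;> rcases v with (_ | j) | j <;> grind [admittance, subscript]

/-- The function `a₀ ↦ 1`, `a_i ↦ 0`, `x_k ↦ S_{n-1-k}(t) / S_{n-1}(t)`, whose restriction to `Γ_n`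
solves the Dirichlet problem there when `t = 2 + β / α`. The constructor `x i` stands for `x_{i+1}`,
and the subscripts of `S` are integers, so the subtraction does not truncate. -/
noncomputable def potential (t : K) (n : ℕ) : LadderVertex → K
  | a 0 => 1
  | a (_ + 1) => 0
  | x i => (S K (n - 1 - (i + 1 : ℕ))).eval t / (S K (n - 1)).eval t

theorem potential_node {t : K} {n : ℕ} (hS : (S K (n - 1)).eval t ≠ 0) (k : ℕ) :
    potential t n (node k) = (S K (n - 1 - k)).eval t / (S K (n - 1)).eval t := by
  cases k with
  | zero => simp [node, potential, hS]
  | succ k => rfl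

theorem dist_node [LinearOrder K] (hα : 0 < α) (hβ : 0 < β) (k : ℕ) :
    (ladderGraph α β).dist (a 0) (node k) = k := by
  have hconn := ladderGraph_connected hα hβ
  apply le_antisymm
  · induction k with
    | zero => exact SimpleGraph.dist_self.le
    | succ k ih =>
      have hadj : (ladderGraph α β).Adj (node k) (node (k + 1)) := by
        change admittance α β _ _ ≠ 0
        rw [admittance_node_node_succ]
        exact hα.ne'
      have := hconn.dist_triangle (u := a 0) (v := node k) (w := node (k + 1))
      rw [SimpleGraph.dist_eq_one_iff_adj.mpr hadj] at this
      omega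
  · have h := le_add_dist_of_forall_adj (subscript_le_of_adj (α := α) (β := β))
      (hconn.preconnected (a 0) (node k))
    rwa [subscript_node, subscript, zero_add] at h

end Field

variable {K : Type*} [Field K] [LinearOrder K] [IsStrictOrderedRing K] {α β : K}

theorem laplacian_ladder_a_zero (hα : 0 < α) (hβ : 0 < β) (v : LadderVertex → K) :
    (ladder α β hα hβ).laplacian v (a 0) = (v (x 0) - v (a 0)) * α := by
  change ∑ᶠ y, (v y - v (a 0)) * admittance α β (a 0) y = _
  rw [finsum_eq_single _ (x 0)]
  · simp [admittance]
  · rintro (i | _ | i) hy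
    · simp [admittance]
    · exact absurd rfl hy
    · simp [admittance]

theorem laplacian_ladder_x (hα : 0 < α) (hβ : 0 < β) (v : LadderVertex → K) (k : ℕ) :
    (ladder α β hα hβ).laplacian v (x k) =
      (v (node k) - v (x k)) * α + (v (x (k + 1)) - v (x k)) * α
        + (v (a (k + 1)) - v (x k)) * β := by
  classical
  have hsupp : (Function.support fun y => (v y - v (x k)) * admittance α β (x k) y) ⊆
      ({node k, x (k + 1), a (k + 1)} : Finset LadderVertex) := fun y hy => by
    have hy : admittance α β (x k) y ≠ 0 := right_ne_zero_of_mul hy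
    rcases y with (_ | j) | j <;> rcases k with _ | k <;> grind [admittance, node]
  have hprev : admittance α β (x k) (node k) = α := by
    rw [admittance_symm]
    exact admittance_node_node_succ α β k
  change ∑ᶠ y, (v y - v (x k)) * admittance α β (x k) y = _
  have hnotMem : node k ∉ ({x (k + 1), a (k + 1)} : Finset LadderVertex) := by
    cases k <;> grind [node]
  rw [finsum_eq_sum_of_support_subset _ hsupp, Finset.sum_insert hnotMem,
    Finset.sum_insert (by simp), Finset.sum_singleton, hprev, ← add_assoc]
  simp [admittance]

theorem laplacian_potential (hα : 0 < α) (hβ : 0 < β) {n : ℕ}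
    (hS : (S K (n - 1)).eval (2 + β / α) ≠ 0) (k : ℕ) :
    (ladder α β hα hβ).laplacian (potential (2 + β / α) n) (x k) = 0 := by
  rw [laplacian_ladder_x]
  change (_ - potential _ _ (node (k + 1))) * α + (potential _ _ (node (k + 2))
    - potential _ _ (node (k + 1))) * α + (0 - potential _ _ (node (k + 1))) * β = 0
  simp only [potential_node hS]
  have hrec := eval_S_add_one (2 + β / α) (n - 1 - (k + 1 : ℕ))
  rw [show (n - 1 - (k + 1 : ℕ) + 1 : ℤ) = n - 1 - k by push_cast; ring,
    show (n - 1 - (k + 1 : ℕ) - 1 : ℤ) = n - 1 - (k + 2 : ℕ) by push_cast; ring] at hrec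
  rw [hrec]
  field_simp
  ring

theorem isDirichletSolution_potential (hα : 0 < α) (hβ : 0 < β) {n : ℕ} (hn : n ≠ 0) :
    ((ladder α β hα hβ).exhaustion n hn).IsDirichletSolution
      fun u => potential (2 + β / α) n (u : LadderVertex) := by
  have hS : (S K (n - 1)).eval (2 + β / α) ≠ 0 :=
    (eval_S_sub_one_pos (le_add_of_nonneg_right (div_pos hβ hα).le) hn).ne'
  refine Network.isDirichletSolution_exhaustion hn ?_ ?_ ?_ rfl
  · rintro ((_ | i) | k) hB ha₀
    · exact absurd rfl ha₀
    · exact absurd ⟨i, rfl⟩ hB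
    · exact laplacian_potential hα hβ hS k
  · rintro _ ⟨i, rfl⟩
    rfl
  · rintro ((_ | i) | k) hdist
    · exact absurd (SimpleGraph.dist_self.symm.trans hdist).symm hn
    · rfl
    · obtain rfl : k + 1 = n := (dist_node hα hβ (k + 1)).symm.trans hdist
      simp [potential]

theorem existsUnique_isDirichletSolution_exhaustion (hα : 0 < α) (hβ : 0 < β) {n : ℕ}
    (hn : n ≠ 0) : ∃! v, ((ladder α β hα hβ).exhaustion n hn).IsDirichletSolution v :=
  ⟨_, isDirichletSolution_potential hα hβ hn, fun _ hv =>
    hv.eq (isDirichletSolution_potential hα hβ hn)⟩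

theorem effectiveAdmittance_exhaustion_ladder (hα : 0 < α) (hβ : 0 < β) {n : ℕ} (hn : n ≠ 0) :
    ((ladder α β hα hβ).exhaustion n hn).effectiveAdmittance =
      α * (1 - (S K (n - 2)).eval (2 + β / α) / (S K (n - 1)).eval (2 + β / α)) := by
  rw [Network.effectiveAdmittance_exhaustion hn (isDirichletSolution_potential hα hβ hn)]
  refine (congrArg Neg.neg (laplacian_ladder_a_zero hα hβ _)).trans ?_
  simp only [potential]
  rw [show (n - 1 - (0 + 1 : ℕ) : ℤ) = n - 2 by push_cast; ring]
  ring

theorem effectiveAdmittance_exhaustion_ladder_succ_sub (hα : 0 < α) (hβ : 0 < β) {n : ℕ}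
    (hn : n ≠ 0) :
    ((ladder α β hα hβ).exhaustion (n + 1) n.succ_ne_zero).effectiveAdmittance
        - ((ladder α β hα hβ).exhaustion n hn).effectiveAdmittance =
      -(α / ((S K (n - 1)).eval (2 + β / α) * (S K n).eval (2 + β / α))) := by
  have ht : 2 ≤ 2 + β / α := le_add_of_nonneg_right (div_pos hβ hα).le
  rw [effectiveAdmittance_exhaustion_ladder, effectiveAdmittance_exhaustion_ladder]
  generalize 2 + β / α = t at ht ⊢
  have hpred : (S K (n - 1)).eval t ≠ 0 := (eval_S_sub_one_pos ht hn).ne'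
  have hself : (S K n).eval t ≠ 0 := (eval_S_pos ht n).ne'
  have hinv := eval_S_sq_sub_mul t (n - 1)
  rw [sub_add_cancel, sub_sub, one_add_one_eq_two] at hinv
  rw [show ((n + 1 : ℕ) - 2 : ℤ) = n - 1 by push_cast; ring,
    show ((n + 1 : ℕ) - 1 : ℤ) = n by push_cast; ring]
  field_simp
  linear_combination -hinv

end LadderVertex

/-! ### Leading terms in the Levi-Civita field -/

namespace LeviCivita

theorem exists_nat_of_mem_support_ofPowerSeries {φ : PowerSeries ℝ} {q : ℚ}
    (hq : q ∈ (HahnSeries.ofPowerSeries ℚ ℝ φ).support) :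
    ∃ k : ℕ, PowerSeries.coeff k φ ≠ 0 ∧ q = k := by
  obtain ⟨k, hk, rfl⟩ := HahnSeries.support_embDomain_subset hq
  exact ⟨k, hk, rfl⟩

theorem leftFinite_support_ofPowerSeries (φ : PowerSeries ℝ) :
    LeftFinite (HahnSeries.ofPowerSeries ℚ ℝ φ).support := fun r => by
  refine ((Set.finite_lt_nat ⌈r⌉₊).image (Nat.cast : ℕ → ℚ)).subset ?_
  rintro q ⟨hq, hr⟩
  obtain ⟨k, -, rfl⟩ := exists_nat_of_mem_support_ofPowerSeries hq
  exact ⟨k, Nat.lt_ceil.mpr hr, rfl⟩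

/-- The embedding `∑ c_k X^k ↦ ∑ c_k τ^k` of the formal power series into the Levi-Civita field. -/
noncomputable def ofPowerSeries : PowerSeries ℝ →+* LeviCivita where
  toFun φ := ⟨toLex (HahnSeries.ofPowerSeries ℚ ℝ φ), leftFinite_support_ofPowerSeries φ⟩
  map_one' := Subtype.ext (map_one (HahnSeries.ofPowerSeries ℚ ℝ))
  map_mul' φ ψ := Subtype.ext (map_mul (HahnSeries.ofPowerSeries ℚ ℝ) φ ψ)
  map_zero' := Subtype.ext (map_zero (HahnSeries.ofPowerSeries ℚ ℝ))
  map_add' φ ψ := Subtype.ext (map_add (HahnSeries.ofPowerSeries ℚ ℝ) φ ψ)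

theorem ofPowerSeries_C (c : ℝ) : ofPowerSeries (PowerSeries.C c) = const c :=
  Subtype.ext (HahnSeries.ofPowerSeries_C c)

theorem ofPowerSeries_X : ofPowerSeries PowerSeries.X = τ :=
  Subtype.ext HahnSeries.ofPowerSeries_X

theorem ofPowerSeries_inv {φ : PowerSeries ℝ} (hφ : PowerSeries.constantCoeff φ ≠ 0) :
    ofPowerSeries φ⁻¹ = (ofPowerSeries φ)⁻¹ := by
  apply eq_inv_of_mul_eq_one_right
  rw [← map_mul, PowerSeries.mul_inv_cancel φ hφ, map_one]

theorem coeff_sub (f g : LeviCivita) (q : ℚ) : (f - g).coeff q = f.coeff q - g.coeff q :=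
  HahnSeries.coeff_sub

theorem coeff_monomial_self (q : ℚ) (c : ℝ) : (monomial q c).coeff q = c :=
  HahnSeries.coeff_single_same q c

theorem coeff_monomial_of_ne {q r : ℚ} (h : r ≠ q) (c : ℝ) : (monomial q c).coeff r = 0 :=
  HahnSeries.coeff_single_of_ne h

theorem coeff_monomial_mul (q r : ℚ) (c : ℝ) (f : LeviCivita) :
    (monomial q c * f).coeff r = c * f.coeff (r - q) :=
  HahnSeries.coeff_single_mul

theorem monomial_neg (q : ℚ) (c : ℝ) : monomial q (-c) = -monomial q c :=
  Subtype.ext (HahnSeries.single_neg (Γ := ℚ) q c)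

theorem monomial_mul_monomial (q r : ℚ) (c d : ℝ) :
    monomial q c * monomial r d = monomial (q + r) (c * d) :=
  Subtype.ext HahnSeries.single_mul_single

theorem inv_monomial (q : ℚ) {c : ℝ} (hc : c ≠ 0) : (monomial q c)⁻¹ = monomial (-q) c⁻¹ := by
  apply inv_eq_of_mul_eq_one_right
  rw [monomial_mul_monomial, add_neg_cancel, mul_inv_cancel₀ hc]
  rfl

theorem const_mul_inv_τ (c : ℝ) : const c * τ⁻¹ = monomial (-1 : ℤ) c := by
  rw [const, τ, inv_monomial _ one_ne_zero, monomial_mul_monomial]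
  norm_num

theorem isLittleO_monomial_mul_ofPowerSeries (m : ℤ) (c : ℝ) {φ : PowerSeries ℝ}
    (hφ : PowerSeries.constantCoeff φ = 0) : (monomial m c * ofPowerSeries φ).IsLittleO m := by
  intro q hq
  rw [coeff_monomial_mul] at hq
  obtain ⟨k, hk, hqk⟩ := exists_nat_of_mem_support_ofPowerSeries (right_ne_zero_of_mul hq)
  have hk0 : k ≠ 0 := by
    rintro rfl
    exact hk (by rwa [PowerSeries.coeff_zero_eq_constantCoeff_apply])
  refine ⟨m + k, by omega, ?_⟩
  push_cast
  linarith

theorem isLittleO_monomial_div_ofPowerSeries_sub (m : ℤ) (c : ℝ) {φ : PowerSeries ℝ}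
    (hφ : PowerSeries.constantCoeff φ ≠ 0) :
    (monomial m c / ofPowerSeries φ
      - monomial m (c / PowerSeries.constantCoeff φ)).IsLittleO m := by
  have hlead : monomial m (c / PowerSeries.constantCoeff φ) =
      monomial m c * ofPowerSeries (PowerSeries.C (PowerSeries.constantCoeff φ)⁻¹) := by
    rw [ofPowerSeries_C, const, monomial_mul_monomial, add_zero, div_eq_mul_inv]
  rw [div_eq_mul_inv, ← ofPowerSeries_inv hφ, hlead, ← mul_sub, ← map_sub]
  apply isLittleO_monomial_mul_ofPowerSeries
  rw [map_sub, PowerSeries.constantCoeff_inv, PowerSeries.constantCoeff_C, sub_self]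

theorem IsLittleO.coeff_eq_zero {f : LeviCivita} {m : ℤ} (hf : f.IsLittleO m) {q : ℚ}
    (hq : q ≤ m) : f.coeff q = 0 := by
  by_contra h
  obtain ⟨k, hk, rfl⟩ := hf q h
  have : k ≤ m := Int.cast_le.mp hq
  omega

theorem IsLittleO.neg {f : LeviCivita} {m : ℤ} (hf : f.IsLittleO m) : (-f).IsLittleO m :=
  fun q hq => hf q (neg_ne_zero.mp hq)

theorem monomial_lt_of_isLittleO {f : LeviCivita} {m : ℤ} {q : ℚ} (hmq : m < q) {c : ℝ}
    (hc : 0 < c) (d : ℝ) (hf : (f - monomial m c).IsLittleO m) : monomial q d < f := by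
  have hcoeff : ∀ r : ℚ, r ≤ m → f.coeff r = (monomial m c).coeff r := fun r hr =>
    sub_eq_zero.mp ((coeff_sub _ _ r).symm.trans (hf.coeff_eq_zero hr))
  refine (HahnSeries.lt_iff _ _).mpr ⟨m, fun r hr => ?_, ?_⟩
  · change (monomial q d).coeff r = f.coeff r
    rw [hcoeff r hr.le, coeff_monomial_of_ne hr.ne, coeff_monomial_of_ne (hr.trans hmq).ne]
  · change (monomial q d).coeff m < f.coeff m
    rwa [hcoeff m le_rfl, coeff_monomial_self, coeff_monomial_of_ne hmq.ne]

theorem monomial_lt_abs_of_isLittleO {f : LeviCivita} {m : ℤ} {q : ℚ} (hmq : m < q) {c : ℝ}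
    (hc : c ≠ 0) (d : ℝ) (hf : (f - monomial m c).IsLittleO m) : monomial q d < |f| := by
  rcases hc.lt_or_gt with hneg | hpos
  · refine (monomial_lt_of_isLittleO hmq (neg_pos.mpr hneg) d ?_).trans_le (neg_le_abs f)
    rw [monomial_neg, ← neg_sub']
    exact hf.neg
  · exact (monomial_lt_of_isLittleO hmq hpos d hf).trans_le (le_abs_self f)

end LeviCivita

/-! ### Divergence of the `CL`-network -/

theorem not_isCauSeq_of_le_abv_sub {K R : Type*} [Field K] [LinearOrder K] [IsStrictOrderedRing K]
    [Ring R] {abv : R → K} {f : ℕ → R} {ε : K} (hε : 0 < ε)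
    (hf : ∀ n, ε ≤ abv (f (n + 1) - f n)) : ¬ IsCauSeq abv f := fun h => by
  obtain ⟨N, hN⟩ := h ε hε
  exact (hf N).not_gt (hN (N + 1) N.le_succ)

theorem not_tendsto_of_le_abs_sub {M : Type*} [AddCommGroup M] [LinearOrder M]
    [IsOrderedAddMonoid M] [TopologicalSpace M] [OrderTopology M] {f : ℕ → M} {ε : M} (hε : 0 < ε)
    (hf : ∀ n, ε ≤ |f (n + 1) - f n|) : ¬ ∃ p, Filter.Tendsto f Filter.atTop (nhds p) := by
  rintro ⟨p, hp⟩
  have hdiff : Filter.Tendsto (fun n => f (n + 1) - f n) Filter.atTop (nhds 0) := by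
    simpa using (hp.comp (Filter.tendsto_add_atTop_nat 1)).sub hp
  obtain ⟨N, hN⟩ := (hdiff.eventually (eventually_abs_sub_lt 0 hε)).exists
  rw [sub_zero] at hN
  exact (hf N).not_gt hN

section CLNetwork

open LeviCivita Polynomial.Chebyshev
open Polynomial (eval)

variable {L C : ℝ}

theorem const_mul_τ_div_const_mul_inv_τ (hC : C ≠ 0) :
    const L⁻¹ * τ / (const C * τ⁻¹) =
      ofPowerSeries (PowerSeries.C (L⁻¹ * C⁻¹) * PowerSeries.X ^ 2) := by
  rw [div_eq_mul_inv, const_mul_inv_τ, inv_monomial _ hC, map_mul, map_pow, ofPowerSeries_C,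
    ofPowerSeries_X, pow_two, const, const, τ]
  simp only [monomial_mul_monomial]
  norm_num

theorem isLittleO_effectiveAdmittance_succ_sub (hL : 0 < L) (hC : 0 < C) {n : ℕ} (hn : n ≠ 0) :
    IsLittleO (((clNetwork L C hL hC).exhaustion (n + 1) n.succ_ne_zero).effectiveAdmittance
        - ((clNetwork L C hL hC).exhaustion n hn).effectiveAdmittance
        - const (-C / ((n : ℝ) * (n + 1))) * τ⁻¹) (-1) := by
  let t : PowerSeries ℝ := 2 + PowerSeries.C (L⁻¹ * C⁻¹) * PowerSeries.X ^ 2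
  let W : PowerSeries ℝ := (S _ (n - 1)).eval t * (S _ n).eval t
  have ht : 2 + const L⁻¹ * τ / (const C * τ⁻¹) = ofPowerSeries t := by
    rw [const_mul_τ_div_const_mul_inv_τ hC.ne', map_add, map_ofNat]
  have hW : PowerSeries.constantCoeff W = (n : ℝ) * (n + 1) := by
    have ht0 : PowerSeries.constantCoeff t = 2 := by simp [t, map_ofNat]
    rw [map_mul, map_eval_S, map_eval_S, ht0, S_eval_two, S_eval_two]
    push_cast
    ring
  have hW0 : PowerSeries.constantCoeff W ≠ 0 := by rw [hW]; positivity
  rw [clNetwork, LadderVertex.effectiveAdmittance_exhaustion_ladder_succ_sub _ _ hn, ht,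
    ← map_eval_S, ← map_eval_S, ← map_mul, const_mul_inv_τ, const_mul_inv_τ, ← neg_div,
    ← monomial_neg, ← hW]
  exact isLittleO_monomial_div_ofPowerSeries_sub (-1) (-C) hW0

theorem τ_lt_abs_effectiveAdmittance_succ_sub (hL : 0 < L) (hC : 0 < C) {n : ℕ} (hn : n ≠ 0) :
    τ < |((clNetwork L C hL hC).exhaustion (n + 1) n.succ_ne_zero).effectiveAdmittance
        - ((clNetwork L C hL hC).exhaustion n hn).effectiveAdmittance| := by
  have hlead : -C / ((n : ℝ) * (n + 1)) ≠ 0 := div_ne_zero (neg_ne_zero.mpr hC.ne') (by positivity)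
  have hdiff := isLittleO_effectiveAdmittance_succ_sub hL hC hn
  rw [const_mul_inv_τ] at hdiff
  exact monomial_lt_abs_of_isLittleO (by norm_num) hlead 1 hdiff

end CLNetwork

theorem mainTheorem10 (L C : ℝ) (hL : 0 < L) (hC : 0 < C) :
    -- each finite network has a well-defined effective admittance
    (∀ (n : ℕ) (hn : n ≠ 0),
      ∃! v, ((clNetwork L C hL hC).exhaustion n hn).IsDirichletSolution v) ∧
    -- the sequence `P_eff(Γ_1), P_eff(Γ_2), …` has no limit in the order topology
    (¬ ∃ p : LeviCivita, Filter.Tendsto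
      (fun n : ℕ =>
        ((clNetwork L C hL hC).exhaustion (n + 1) n.succ_ne_zero).effectiveAdmittance)
      Filter.atTop (nhds p)) ∧
    -- the leading term of consecutive differences, of order `τ⁻¹`
    (∀ (n : ℕ) (hn : n ≠ 0), LeviCivita.IsLittleO
      (((clNetwork L C hL hC).exhaustion (n + 1) n.succ_ne_zero).effectiveAdmittance
        - ((clNetwork L C hL hC).exhaustion n hn).effectiveAdmittance
        - LeviCivita.const (-C / ((n : ℝ) * (n + 1))) * LeviCivita.τ⁻¹) (-1)) ∧
    (∀ (n : ℕ) (hn : n ≠ 0), LeviCivita.τ <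
      |((clNetwork L C hL hC).exhaustion (n + 1) n.succ_ne_zero).effectiveAdmittance
        - ((clNetwork L C hL hC).exhaustion n hn).effectiveAdmittance|) ∧
    -- the sequence is not Cauchy
    ¬ IsCauSeq (fun t : LeviCivita => |t|) (fun n : ℕ =>
      ((clNetwork L C hL hC).exhaustion (n + 1) n.succ_ne_zero).effectiveAdmittance) := by
  have hgap := fun (n : ℕ) (hn : n ≠ 0) => τ_lt_abs_effectiveAdmittance_succ_sub hL hC hn
  exact ⟨fun _ hn => LadderVertex.existsUnique_isDirichletSolution_exhaustion _ _ hn,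
    not_tendsto_of_le_abs_sub LeviCivita.τ_pos fun n => (hgap (n + 1) n.succ_ne_zero).le,
    fun _ hn => isLittleO_effectiveAdmittance_succ_sub hL hC hn,
    hgap,
    not_isCauSeq_of_le_abv_sub LeviCivita.τ_pos fun n => (hgap (n + 1) n.succ_ne_zero).le⟩
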